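/- Let $D$ be a division ring with center $F$ and multiplicative group $D^* = D\setminus\{0\}$. Suppose that $D$ is weakly locally finite: for every finite subset $S$ of $D$, the division subring of $D$ generated by $S$ is centrally finite, i.e. a finite-dimensional vector space over its own center. Let $N$ be a subnormal subgroup of $D^*$, i.e. there is a finite chain of subgroups $N = N_1 \trianglelefteq N_2 \trianglelefteq \dots \trianglelefteq N_r = D^*$, each normal in the next. If $N$ is radical over $F$, i.e. for every $x \in N$ there is a positive integer $n(x)$, depending on $x$, with $x^{n(x)} \in F$, then $N$ is central, i.e. $N \subseteq F$. -/

import Mathlib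

/-- A division ring is centrally finite if it is a finite-dimensional vector space over its
center. -/
def IsCentrallyFinite (D : Type*) [DivisionRing D] : Prop :=
  FiniteDimensional (Subring.center D) D

/-- A division ring `D` is weakly locally finite if, for every finite subset `S` of `D`, the
division subring of `D` generated by `S` is centrally finite, that is, finite-dimensional over its
own center. (Mathlib's `Subfield D` is the type of division subrings of the division ring `D`;
commutativity is not part of it.) -/
def IsWeaklyLocallyFinite (D : Type*) [DivisionRing D] : Prop :=
  ∀ S : Set D, S.Finite → IsCentrallyFinite (Subfield.closure S)

/-- A subset `S` of `D` is radical over a subring `K` if every element of `S` has some positive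
power (the exponent may depend on the element) lying in `K`. -/
def IsRadicalOver {D : Type*} [DivisionRing D] (S : Set D) (K : Subring D) : Prop :=
  ∀ x ∈ S, ∃ n : ℕ, 0 < n ∧ x ^ n ∈ K

/-! Given `a` in `N` and `b` in `D`, work in the division subring they generate, finite-dimensional
over its center `F`. If `F` is integral over `ℤ`, Wedderburn's little theorem makes it commutative
(`mul_comm_of_forall_isIntegral`). Otherwise `F` has a nontrivial valuation ring, and a
multiplicative lattice `L` yields congruence neighbourhoods `1 + tL`. Near `1`, torsion is trivial,
and a central power forces pure inseparability over the center (`exists_pow_expChar_mem_center`).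

Take `u = 1 + f b` so close to `1` that the iterates of `c ↦ ⁅c, a⁆` stay near `1`. By subnormality
some iterate lies in `N`, so it is purely inseparable over the center. If it is central,
`commute_of_commute_iterate_commutator` climbs back: a `⁅c, a⁆` commuting with `a` is torsion, hence
`1`. So `u`, and with it `b`, commutes with `a`.

Noncentral purely inseparable elements of `N` are excluded beforehand
(`mem_center_of_pow_expChar_mem_center`): if `a` is one with `a ^ p` central, then `a x a⁻¹ = x + 1`
for some `x`, and the same argument runs with `b = x`, inside a commutative group stable under
conjugation by `a`. -/

open scoped commutatorElement

/-! ### Multiplicative lattices over a valuation ring -/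

/-- A full lattice over a valuation subring `V` of `F` in a division algebra `D`, closed under
multiplication, in which every nonzero element of `D` has a primitive multiple. -/
structure MulLattice {F : Type*} [Field F] (V : ValuationSubring F) (D : Type*) [DivisionRing D]
    [Algebra F D] extends NonUnitalSubring D where
  smul_mem : ∀ f ∈ V, ∀ x ∈ carrier, f • x ∈ carrier
  exists_primitive : ∀ x : D, x ≠ 0 → ∃ f : F, f ≠ 0 ∧ f • x ∈ carrier ∧
    ∀ g : F, g • f • x ∈ carrier → g ∈ V

theorem ValuationSubring.exists_primitive_multiple {F ι : Type*} [Field F] [Finite ι]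
    (V : ValuationSubring F) (c : ι → F) (hc : ∃ i, c i ≠ 0) :
    ∃ f : F, f ≠ 0 ∧ (∀ i, f * c i ∈ V) ∧ ∃ i, f * c i = 1 := by
  obtain ⟨i₀, hi₀⟩ := hc
  have : Nonempty ι := ⟨i₀⟩
  obtain ⟨j, hj⟩ := Finite.exists_max (fun i => V.valuation (c i))
  have hj0 : c j ≠ 0 := by
    intro h
    have := hj i₀
    simp only [h, map_zero, le_zero_iff, map_eq_zero] at this
    exact hi₀ this
  refine ⟨(c j)⁻¹, inv_ne_zero hj0, fun i => ?_, j, inv_mul_cancel₀ hj0⟩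
  rw [← V.valuation_le_one_iff, map_mul, map_inv₀]
  have h0 : V.valuation (c j) ≠ 0 := by simpa using hj0
  calc (V.valuation (c j))⁻¹ * V.valuation (c i) ≤ (V.valuation (c j))⁻¹ * V.valuation (c j) :=
        mul_le_mul_right (hj i) _
    _ = 1 := inv_mul_cancel₀ h0

theorem ValuationSubring.exists_common_denominator {F ι : Type*} [Field F] [Finite ι]
    (V : ValuationSubring F) (c : ι → F) : ∃ f : F, f ≠ 0 ∧ ∀ i, f * c i ∈ V := by
  by_cases hc : ∃ i, c i ≠ 0
  · obtain ⟨f, hf, h, -⟩ := V.exists_primitive_multiple c hc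
    exact ⟨f, hf, h⟩
  · push Not at hc
    exact ⟨1, one_ne_zero, fun i => by simp [hc i, V.zero_mem]⟩

theorem MulLattice.nonempty {F : Type*} [Field F] (V : ValuationSubring F) (D : Type*)
    [DivisionRing D] [Algebra F D] [FiniteDimensional F D] : Nonempty (MulLattice V D) := by
  let b := Module.finBasis F D
  obtain ⟨s, hs, hsc⟩ := V.exists_common_denominator
    (fun t : Fin _ × Fin _ × Fin _ => b.repr (b t.1 * b t.2.1) t.2.2)
  have key : ∀ x y : D, ∀ k, b.repr (x * y) k =
      ∑ i, ∑ j, b.repr x i * b.repr y j * b.repr (b i * b j) k := by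
    intro x y k
    conv_lhs => rw [← b.sum_repr x, ← b.sum_repr y]
    simp only [Finset.sum_mul_sum, smul_mul_smul_comm, map_sum, map_smul, Finsupp.coe_finsetSum,
      Finset.sum_apply, Finsupp.smul_apply, smul_eq_mul]
  -- The `V`-span of the basis, shrunk by the common denominator `s` of the structure constants: a
  -- product of two elements of `s` times the span gains a spare factor `s`.
  refine ⟨{ carrier := {x | ∀ i, s⁻¹ * b.repr x i ∈ V}
            add_mem' := ?_
            zero_mem' := by simp [V.zero_mem]
            neg_mem' := ?_
            mul_mem' := ?_
            smul_mem := ?_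
            exists_primitive := ?_ }⟩
  · intro x y hx hy i
    simpa [mul_add] using V.add_mem _ _ (hx i) (hy i)
  · intro x y hx hy k
    rw [key, Finset.mul_sum]
    refine sum_mem fun i _ => ?_
    rw [Finset.mul_sum]
    refine sum_mem fun j _ => ?_
    have := V.mul_mem _ _ (V.mul_mem _ _ (hx i) (hy j)) (hsc (i, j, k))
    convert this using 1
    field_simp
  · intro x hx i
    simpa using V.neg_mem _ (hx i)
  · intro f hf x hx i
    simpa [mul_left_comm] using V.mul_mem _ _ hf (hx i)
  · intro x hx
    have : ∃ i, s⁻¹ * b.repr x i ≠ 0 := by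
      by_contra! h
      apply hx
      apply b.repr.injective
      ext i
      simpa [hs] using h i
    obtain ⟨f, hf, h1, i, hi⟩ := V.exists_primitive_multiple _ this
    refine ⟨f, hf, fun i => ?_, fun g hg => ?_⟩
    · simpa [mul_left_comm] using h1 i
    · have h2 := hg i
      simp only [map_smul, Finsupp.smul_apply, smul_eq_mul] at h2
      rw [show s⁻¹ * (g * (f * b.repr x i)) = g * (f * (s⁻¹ * b.repr x i)) by ring, hi,
        mul_one] at h2
      exact h2

/-! ### Choice of the valuation and of the scale `π` -/

theorem not_isIntegral_inv_two {F : Type*} [Field F] [CharZero F] : ¬ IsIntegral ℤ (2⁻¹ : F) := by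
  intro h
  have h' : IsIntegral ℤ (algebraMap ℚ F (2⁻¹ : ℚ)) := by simpa using h
  rw [isIntegral_algebraMap_iff (algebraMap ℚ F).injective] at h'
  obtain ⟨n, hn⟩ := IsIntegrallyClosed.isIntegral_iff.1 h'
  have h2 : (n : ℚ) * 2 = 1 := by
    simp only [algebraMap_int_eq, eq_intCast] at hn
    rw [hn]; norm_num
  have h3 : n * 2 = 1 := by exact_mod_cast h2
  omega

/-- An integrally closed subring is the intersection of the valuation rings containing it. -/
theorem exists_valuationSubring_notMem {F : Type*} [Field F] {x : F} (hx : ¬ IsIntegral ℤ x) :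
    ∃ V : ValuationSubring F, x ∉ V := by
  have : IsIntegrallyClosedIn (integralClosure ℤ F).toSubring F :=
    inferInstanceAs (IsIntegrallyClosedIn (integralClosure ℤ F) F)
  obtain ⟨V, -, hV⟩ := Subring.exists_le_valuationSubring_of_isIntegrallyClosedIn
    (K := F) (R := (integralClosure ℤ F).toSubring) (x := x) hx
  exact ⟨V, hV⟩

/-- A valuation subring together with a scale `π` of its maximal ideal at which nonzero primes
are not infinitesimal. -/
theorem exists_valuationSubring_scale {F : Type*} [Field F] (hF : ∃ x : F, ¬ IsIntegral ℤ x) :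
    ∃ (V : ValuationSubring F) (π : F), π ≠ 0 ∧ π ∈ V ∧ π⁻¹ ∉ V ∧
      ∀ q : ℕ, q.Prime → (q : F) ≠ 0 → π⁻¹ * q ∉ V := by
  obtain ⟨p, hp⟩ := CharP.exists F
  rcases CharP.char_is_prime_or_zero F p with hpp | rfl
  · obtain ⟨x, hx⟩ := hF
    obtain ⟨V, hV⟩ := exists_valuationSubring_notMem hx
    have hx0 : x ≠ 0 := fun h => hV (h ▸ V.zero_mem)
    refine ⟨V, x⁻¹, inv_ne_zero hx0, (V.mem_or_inv_mem x).resolve_left hV, by simpa using hV,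
      fun q hq hq0 h => hV ?_⟩
    have : Fact p.Prime := ⟨hpp⟩
    -- A prime nonzero in `F` is a unit of the prime field, which lies in `V`.
    have hinv : (q : F) * (q : F) ^ (p - 2) = 1 := by
      have h1 : ((q : ZMod p)) ^ (p - 1) = 1 := by
        apply ZMod.pow_card_sub_one_eq_one
        rw [Ne, CharP.cast_eq_zero_iff (ZMod p) p]
        rwa [Ne, CharP.cast_eq_zero_iff F p] at hq0
      have h2 := congrArg (ZMod.castHom (dvd_refl p) F) h1
      simp only [map_pow, map_natCast, map_one] at h2
      rw [← pow_succ', show p - 2 + 1 = p - 1 by have := hpp.two_le; omega, h2]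
    have h3 := V.mul_mem _ _ h (pow_mem (natCast_mem V q) (p - 2))
    rwa [mul_assoc, hinv, inv_inv, mul_one] at h3
  · have : CharZero F := CharP.charP_to_charZero F
    obtain ⟨V, hV⟩ := exists_valuationSubring_notMem (not_isIntegral_inv_two (F := F))
    have h4 : (4 : F)⁻¹ ∉ V := fun h => hV (by
      have := V.mul_mem _ _ (natCast_mem V 2) h
      norm_num at this ⊢
      exact this)
    -- The scale is `4`, not `2`, because the prime `2` itself must not be divisible by `π`.
    refine ⟨V, 4, by norm_num, ?_, h4, fun q hq _ h => ?_⟩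
    · exact_mod_cast natCast_mem V 4
    · rcases hq.eq_two_or_odd' with rfl | ⟨k, rfl⟩
      · apply hV
        norm_num at h ⊢
        exact h
      · apply hV
        have h5 := V.mul_mem _ _ (natCast_mem V 2) h
        have h6 : (2 : F)⁻¹ = (2 : ℕ) * (4⁻¹ * (2 * k + 1 : ℕ)) - (k : F) := by
          push_cast
          ring
        rw [h6]
        exact V.sub_mem h5 (natCast_mem V k)

theorem expChar_of_natCast_prime_eq_zero {R : Type*} [NonAssocSemiring R] [Nontrivial R] {q : ℕ}
    (hq : q.Prime) (h : (q : R) = 0) : ExpChar R q :=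
  have : CharP R q := ringChar.of_eq (CharP.ringChar_of_prime_eq_zero hq h)
  ExpChar.prime hq

/-! ### Congruence neighbourhoods of `1` -/

namespace MulLattice

variable {F : Type*} [Field F] {V : ValuationSubring F} {D : Type*} [DivisionRing D] [Algebra F D]
  (L : MulLattice V D)

theorem smul_mem' {f : F} (hf : f ∈ V) {x : D} (hx : x ∈ L.toNonUnitalSubring) :
    f • x ∈ L.toNonUnitalSubring := L.smul_mem f hf x hx

theorem exists_primitive' {x : D} (hx : x ≠ 0) : ∃ f : F, f ≠ 0 ∧ f • x ∈ L.toNonUnitalSubring ∧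
    ∀ g : F, g • f • x ∈ L.toNonUnitalSubring → g ∈ V := L.exists_primitive x hx

theorem mem_of_smul_one_mem {g : F} (hg : g • (1 : D) ∈ L.toNonUnitalSubring) : g ∈ V := by
  obtain ⟨f, -, h1, h2⟩ := L.exists_primitive' (one_ne_zero (α := D))
  apply h2
  simpa only [smul_mul_assoc, one_mul] using L.toNonUnitalSubring.mul_mem hg h1

theorem exists_smul_mem (x : D) : ∃ f : F, f ≠ 0 ∧ f ∈ V ∧ f • x ∈ L.toNonUnitalSubring := by
  rcases eq_or_ne x 0 with rfl | hx
  · exact ⟨1, one_ne_zero, V.one_mem, by simp⟩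
  obtain ⟨f, hf, h1, -⟩ := L.exists_primitive' hx
  by_cases hV : f ∈ V
  · exact ⟨f, hf, hV, h1⟩
  · refine ⟨1, one_ne_zero, V.one_mem, ?_⟩
    have := L.smul_mem' ((V.mem_or_inv_mem f).resolve_left hV) h1
    rwa [inv_smul_smul₀ hf, ← one_smul F x] at this

/-- The elements congruent to `1` modulo `t` times the lattice. -/
def nearOne (t : F) : Set D := {u | ∃ m ∈ L.toNonUnitalSubring, u = 1 + t • m}

variable {L}

theorem one_mem_nearOne (t : F) : (1 : D) ∈ L.nearOne t :=
  ⟨0, L.toNonUnitalSubring.zero_mem, by simp⟩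

theorem nearOne_mul_subset {s : F} (hs : s ∈ V) (t : F) : L.nearOne (t * s) ⊆ L.nearOne t := by
  rintro _ ⟨m, hm, rfl⟩
  exact ⟨s • m, L.smul_mem' hs hm, by rw [mul_smul]⟩

theorem mul_mem_nearOne {t : F} (ht : t ∈ V) {u v : D} (hu : u ∈ L.nearOne t)
    (hv : v ∈ L.nearOne t) : u * v ∈ L.nearOne t := by
  obtain ⟨m, hm, rfl⟩ := hu
  obtain ⟨n, hn, rfl⟩ := hv
  refine ⟨m + n + t • (m * n), add_mem (add_mem hm hn) (L.smul_mem' ht (mul_mem hm hn)), ?_⟩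
  simp only [mul_add, add_mul, one_mul, mul_one, smul_mul_assoc, mul_smul_comm, smul_add]
  abel

theorem pow_mem_nearOne {t : F} (ht : t ∈ V) {u : D} (hu : u ∈ L.nearOne t) (n : ℕ) :
    u ^ n ∈ L.nearOne t := by
  induction n with
  | zero => simpa using one_mem_nearOne t
  | succ n ih => exact pow_succ u n ▸ mul_mem_nearOne ht ih hu

theorem ne_zero_of_mem_nearOne {t : F} (ht : t⁻¹ ∉ V) {u : D} (hu : u ∈ L.nearOne t) :
    u ≠ 0 := by
  obtain ⟨m, hm, rfl⟩ := hu
  have ht0 : t ≠ 0 := fun h => ht (by simp [h])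
  intro h
  apply ht
  apply L.mem_of_smul_one_mem
  have : t⁻¹ • (1 : D) = -m := by
    rw [inv_smul_eq_iff₀ ht0, smul_neg]
    exact eq_neg_of_add_eq_zero_left h
  exact this ▸ neg_mem hm

/-- No completeness, hence no geometric series: `x = u⁻¹ y` satisfies `x = y - t m x`. Were `x`
outside `L`, a primitive multiple `f x` would be divisible by `t` or by `f`, whichever divides the
other. -/
theorem inv_mul_mem_of_mem_nearOne {t : F} (ht : t⁻¹ ∉ V) {u : D} (hu : u ∈ L.nearOne t)
    {y : D} (hy : y ∈ L.toNonUnitalSubring) : u⁻¹ * y ∈ L.toNonUnitalSubring := by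
  have hu0 := ne_zero_of_mem_nearOne ht hu
  obtain ⟨m, hm, rfl⟩ := hu
  have ht0 : t ≠ 0 := fun h => ht (by simp [h])
  set x := (1 + t • m)⁻¹ * y with hx
  by_contra hxL
  have hx0 : x ≠ 0 := fun h => hxL (h ▸ zero_mem _)
  obtain ⟨f, hf, h1, h2⟩ := L.exists_primitive' hx0
  have hfV : f⁻¹ ∉ V := fun h => hxL (by simpa [inv_smul_smul₀ hf] using L.smul_mem' h h1)
  have hxy : x + t • (m * x) = y := by
    rw [← smul_mul_assoc, ← one_add_mul, hx, mul_inv_cancel_left₀ hu0]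
  have key : f • x = f • y - t • (m * f • x) := by
    rw [← hxy, mul_smul_comm, smul_add, smul_comm f t]
    abel
  have hmx := mul_mem hm h1
  rcases V.mem_or_inv_mem (f * t⁻¹) with h | h
  · apply ht
    apply h2
    rw [key, smul_sub, inv_smul_smul₀ ht0, smul_smul, mul_comm t⁻¹ f]
    exact sub_mem (L.smul_mem' h hy) hmx
  · apply hfV
    apply h2
    rw [key, smul_sub, inv_smul_smul₀ hf, smul_smul]
    refine sub_mem hy (L.smul_mem' ?_ hmx)
    simpa [mul_comm] using h

theorem inv_mem_nearOne {t : F} (ht : t⁻¹ ∉ V) {u : D} (hu : u ∈ L.nearOne t) :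
    u⁻¹ ∈ L.nearOne t := by
  have hu0 := ne_zero_of_mem_nearOne ht hu
  have := @inv_mul_mem_of_mem_nearOne _ _ _ _ _ _ L t ht u hu
  obtain ⟨m, hm, rfl⟩ := hu
  refine ⟨-((1 + t • m)⁻¹ * m), neg_mem (this hm), ?_⟩
  apply mul_left_cancel₀ hu0
  rw [mul_inv_cancel₀ hu0, mul_add, mul_one, mul_smul_comm, mul_neg, mul_inv_cancel_left₀ hu0,
    smul_neg]
  abel

/-! ### Rigidity of torsion near `1` -/

variable {π : F}

/-- An operator of prime order `q`, with `q` not infinitesimal at the scale `π`, that is congruent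
to the identity modulo `π` on a lattice is the identity. -/
theorem eq_one_of_pow_eq_one (hπ : π ∈ V) (hπ0 : π ≠ 0) {q : ℕ} (hq : π⁻¹ * q ∉ V)
    {φ : Module.End F D}
    (hφ : ∀ x ∈ L.toNonUnitalSubring, ∃ m ∈ L.toNonUnitalSubring, φ x = x + π • m)
    (hφq : φ ^ q = 1) : φ = 1 := by
  by_contra hne
  have : ∃ y, φ y - y ≠ 0 := by
    by_contra! h
    exact hne (LinearMap.ext fun y => sub_eq_zero.1 (h y))
  obtain ⟨y, hy⟩ := this
  obtain ⟨f, hf, h1, h2⟩ := L.exists_primitive' hy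
  -- `w` is a primitive vector in the image of `φ - 1`, so it is killed by `1 + φ + ⋯ + φ ^ (q -
  -- 1)`. Modulo `π` this sum acts on `w` as `q`, so `π` would divide `q`.
  set w := f • (φ y - y) with hw
  have hpow : ∀ i : ℕ, ∃ m ∈ L.toNonUnitalSubring, (φ ^ i) w = w + π • m := by
    intro i
    induction i with
    | zero => exact ⟨0, zero_mem _, by simp⟩
    | succ i ih =>
      obtain ⟨m, hm, hi⟩ := ih
      obtain ⟨m', hm', hi'⟩ := hφ _ (add_mem h1 (L.smul_mem' hπ hm))
      refine ⟨m + m', add_mem hm hm', ?_⟩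
      rw [pow_succ', Module.End.mul_apply, hi, hi', smul_add, add_assoc]
  choose m hm hmw using hpow
  have hsum : ∑ i ∈ Finset.range q, (φ ^ i) w = 0 := by
    have h3 : (∑ i ∈ Finset.range q, φ ^ i) * (φ - 1) = 0 := by
      rw [geom_sum_mul, hφq, sub_self]
    have h4 := congrArg (fun ψ : Module.End F D => ψ (f • y)) h3
    simpa [LinearMap.sum_apply, hw, smul_sub, Finset.smul_sum] using h4
  have h5 : (q : F) • w = π • (-∑ i ∈ Finset.range q, m i) := by
    simp only [hmw, Finset.sum_add_distrib, Finset.sum_const, Finset.card_range,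
      ← Finset.smul_sum] at hsum
    rw [smul_neg, Nat.cast_smul_eq_nsmul]
    exact eq_neg_of_add_eq_zero_left hsum
  apply hq
  apply h2
  rw [mul_smul, h5, inv_smul_smul₀ hπ0]
  exact neg_mem (sum_mem fun i _ => hm i)

theorem eq_one_of_prime_pow_eq_one (hπ : π ∈ V) (hπ0 : π ≠ 0) {q : ℕ}
    (hq : π⁻¹ * q ∉ V) {c : D} (hc : c ∈ L.nearOne π) (hcq : c ^ q = 1) : c = 1 := by
  obtain ⟨m, hm, hcm⟩ := hc
  have := eq_one_of_pow_eq_one (L := L) hπ hπ0 hq (φ := LinearMap.mulLeft F c)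
    (fun x hx => ⟨m * x, mul_mem hm hx, by simp [hcm, add_mul]⟩)
    (by rw [LinearMap.pow_mulLeft, hcq]; ext; simp)
  simpa using congrArg (fun ψ : Module.End F D => ψ 1) this

theorem mem_center_of_prime_pow_mem_center (hπ : π ∈ V) (hπ0 : π ≠ 0) (hπi : π⁻¹ ∉ V) {q : ℕ}
    (hq : π⁻¹ * q ∉ V) {c : D} (hc : c ∈ L.nearOne π) (hcq : c ^ q ∈ Subring.center D) :
    c ∈ Subring.center D := by
  have hc0 := ne_zero_of_mem_nearOne hπi hc
  obtain ⟨m, hm, hcm⟩ := id hc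
  obtain ⟨n, hn, hcn⟩ := inv_mem_nearOne hπi hc
  have key := eq_one_of_pow_eq_one (L := L) hπ hπ0 hq
    (φ := LinearMap.mulLeft F c * LinearMap.mulRight F c⁻¹)
    (fun x hx => ⟨x * n + m * x + π • (m * (x * n)), add_mem (add_mem (mul_mem hx hn)
      (mul_mem hm hx)) (L.smul_mem' hπ (mul_mem hm (mul_mem hx hn))), by
        rw [Module.End.mul_apply, LinearMap.mulRight_apply, LinearMap.mulLeft_apply, hcn, hcm]
        simp only [mul_add, add_mul, one_mul, mul_one, smul_mul_assoc, mul_smul_comm, smul_add]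
        abel⟩)
    (by
      have hcomm : Commute (LinearMap.mulLeft F c) (LinearMap.mulRight F c⁻¹) :=
        LinearMap.commute_mulLeft_right _ _
      rw [hcomm.mul_pow, LinearMap.pow_mulLeft, LinearMap.pow_mulRight]
      ext x
      rw [Module.End.mul_apply, LinearMap.mulRight_apply, LinearMap.mulLeft_apply, inv_pow,
        ← mul_assoc, ← Subring.mem_center_iff.1 hcq x, mul_assoc,
        mul_inv_cancel₀ (pow_ne_zero _ hc0), mul_one, Module.End.one_apply])
  rw [Subring.mem_center_iff]
  intro y
  have := congrArg (fun ψ : Module.End F D => ψ y) key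
  simp only [Module.End.mul_apply, LinearMap.mulRight_apply, LinearMap.mulLeft_apply,
    Module.End.one_apply, ← mul_assoc] at this
  exact ((mul_inv_eq_iff_eq_mul₀ hc0).1 this).symm

/-- Torsion elements near `1` are trivial. -/
theorem eq_one_of_pow_eq_one_of_mem_nearOne (hπ : π ∈ V) (hπ0 : π ≠ 0)
    (hq : ∀ q : ℕ, q.Prime → (q : F) ≠ 0 → π⁻¹ * q ∉ V) {n : ℕ} (hn : 0 < n) {c : D}
    (hc : c ∈ L.nearOne π) (hcn : c ^ n = 1) : c = 1 := by
  induction n using Nat.recOnMul generalizing c with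
  | zero => omega
  | one => simpa using hcn
  | prime q hqp =>
    by_cases hq0 : (q : F) = 0
    · have := expChar_of_natCast_prime_eq_zero hqp hq0
      have := expChar_of_injective_algebraMap (algebraMap F D).injective q
      have h := sub_pow_expChar_of_commute q (Commute.one_right c)
      rw [hcn, one_pow, sub_self] at h
      exact sub_eq_zero.1 (pow_eq_zero_iff hqp.ne_zero |>.1 h)
    · exact eq_one_of_prime_pow_eq_one hπ hπ0 (hq q hqp hq0) hc hcn
  | mul a b iha ihb =>
    rw [pow_mul] at hcn
    exact iha (Nat.pos_of_mul_pos_right hn) hc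
      (ihb (Nat.pos_of_mul_pos_left hn) (pow_mem_nearOne hπ hc a) hcn)

/-- Elements near `1` with a central power are purely inseparable over the center. -/
theorem exists_pow_expChar_mem_center (p : ℕ) [ExpChar F p] (hπ : π ∈ V) (hπ0 : π ≠ 0)
    (hπi : π⁻¹ ∉ V)
    (hq : ∀ q : ℕ, q.Prime → (q : F) ≠ 0 → π⁻¹ * q ∉ V) {n : ℕ} (hn : 0 < n) {c : D}
    (hc : c ∈ L.nearOne π) (hcn : c ^ n ∈ Subring.center D) :
    ∃ e : ℕ, c ^ p ^ e ∈ Subring.center D := by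
  induction n using Nat.recOnMul generalizing c with
  | zero => omega
  | one => exact ⟨0, by simpa using hcn⟩
  | prime q hqp =>
    by_cases hq0 : (q : F) = 0
    · obtain rfl := (expChar_of_natCast_prime_eq_zero hqp hq0).eq ‹ExpChar F p›
      exact ⟨1, by simpa using hcn⟩
    · exact ⟨0, by simpa using
        mem_center_of_prime_pow_mem_center hπ hπ0 hπi (hq q hqp hq0) hc hcn⟩
  | mul a b iha ihb =>
    rw [pow_mul] at hcn
    obtain ⟨e, he⟩ := ihb (Nat.pos_of_mul_pos_left hn) (pow_mem_nearOne hπ hc a) hcn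
    rw [← pow_mul, mul_comm, pow_mul] at he
    obtain ⟨e', he'⟩ := iha (Nat.pos_of_mul_pos_right hn) (pow_mem_nearOne hπ hc _) he
    exact ⟨e + e', by rwa [pow_add, pow_mul]⟩

end MulLattice

/-! ### Iterated commutators with `a` -/

theorem Subgroup.IsSubnormal.exists_iterate_commutator_mem {G : Type*} [Group G] {N : Subgroup G}
    (hN : N.IsSubnormal) {a : G} (ha : a ∈ N) :
    ∃ r : ℕ, ∀ u : G, (fun c => ⁅c, a⁆)^[r] u ∈ N := by
  induction hN with
  | top => exact ⟨0, fun u => Subgroup.mem_top _⟩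
  | step H K h_le hSubn hN ih =>
    obtain ⟨r, hr⟩ := ih (h_le ha)
    refine ⟨r + 1, fun u => ?_⟩
    rw [Function.iterate_succ_apply', commutatorElement_def]
    have h1 := hN.conj_mem ⟨a, h_le ha⟩ ha ⟨_, hr u⟩
    exact H.mul_mem h1 (H.inv_mem ha)

namespace MulLattice

variable {F : Type*} [Field F] {V : ValuationSubring F} {D : Type*} [DivisionRing D] [Algebra F D]
  {L : MulLattice V D} {π : F}

/-- `⁅u, a⁆ - 1 = (u a - a u) u⁻¹ a⁻¹`, and `s` clears the denominators of `a` and `a⁻¹`. It does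
not depend on `t`, so the bound can be iterated at a cost of one factor `s` per step. -/
theorem exists_commutator_mem_nearOne (hπi : π⁻¹ ∉ V) (a : Dˣ) :
    ∃ s : F, s ≠ 0 ∧ s ∈ V ∧ ∀ t ∈ V, ∀ u : Dˣ, (u : D) ∈ L.nearOne (π * t * s) →
      ((⁅u, a⁆ : Dˣ) : D) ∈ L.nearOne (π * t) := by
  obtain ⟨s₁, h1, h1V, hs₁⟩ := L.exists_smul_mem (a : D)
  obtain ⟨s₂, h2, h2V, hs₂⟩ := L.exists_smul_mem ((a⁻¹ : Dˣ) : D)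
  refine ⟨s₁ * s₂, mul_ne_zero h1 h2, V.mul_mem _ _ h1V h2V, fun t ht u hu => ?_⟩
  have hu' : (u : D) ∈ L.nearOne π := by
    rw [mul_assoc] at hu
    exact nearOne_mul_subset (V.mul_mem _ _ ht (V.mul_mem _ _ h1V h2V)) π hu
  obtain ⟨n, hn, hun⟩ := inv_mem_nearOne hπi hu'
  obtain ⟨m, hm, hum⟩ := hu
  have hk : (m * s₁ • (a : D) - s₁ • (a : D) * m) ∈ L.toNonUnitalSubring :=
    sub_mem (mul_mem hm hs₁) (mul_mem hs₁ hm)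
  have hun' : s₂ • ((u : D)⁻¹ * ((a⁻¹ : Dˣ) : D)) ∈ L.toNonUnitalSubring := by
    rw [← mul_smul_comm]
    exact inv_mul_mem_of_mem_nearOne hπi hu' hs₂
  refine ⟨_, mul_mem hk hun', ?_⟩
  have e : ((⁅u, a⁆ : Dˣ) : D) = 1 + (u * a - a * u) * ((u : D)⁻¹ * ((a⁻¹ : Dˣ) : D)) := by
    rw [commutatorElement_def]
    simp only [Units.val_mul, Units.val_inv_eq_inv_val, sub_mul, mul_assoc]
    rw [mul_inv_cancel_left₀ u.ne_zero, mul_inv_cancel₀ a.ne_zero]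
    abel
  have e2 : (u * a - a * u : D) = (π * t * (s₁ * s₂)) • (m * a - a * m) := by
    rw [hum]
    simp only [add_mul, mul_add, one_mul, mul_one, smul_mul_assoc, mul_smul_comm, smul_sub]
    abel
  rw [e, e2]
  simp only [smul_mul_assoc, mul_smul_comm, ← smul_sub, smul_smul]
  congr 2
  ring

theorem exists_iterate_commutator_mem_nearOne (hπi : π⁻¹ ∉ V) (a : Dˣ) (r : ℕ) :
    ∃ s : F, s ≠ 0 ∧ s ∈ V ∧ ∀ u : Dˣ, (u : D) ∈ L.nearOne (π * s) → ∀ i ≤ r,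
      (((fun c => ⁅c, a⁆)^[i] u : Dˣ) : D) ∈ L.nearOne π := by
  obtain ⟨s, hs, hsV, h⟩ := exists_commutator_mem_nearOne (L := L) hπi a
  refine ⟨s ^ r, pow_ne_zero _ hs, pow_mem hsV r, fun u hu i hi => ?_⟩
  suffices H : ∀ i ≤ r, (((fun c => ⁅c, a⁆)^[i] u : Dˣ) : D) ∈ L.nearOne (π * s ^ (r - i)) from
    nearOne_mul_subset (pow_mem hsV (r - i)) π (H i hi)
  intro i
  induction i with
  | zero => exact fun _ => by simpa using hu
  | succ i ih =>
    intro hi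
    rw [Function.iterate_succ_apply']
    apply h _ (pow_mem hsV _)
    rw [mul_assoc, ← pow_succ, show r - (i + 1) + 1 = r - i by omega]
    exact ih (by omega)

theorem exists_unit_mem_nearOne {t : F} (ht : t⁻¹ ∉ V) (x : D) :
    ∃ f : F, f ≠ 0 ∧ ∃ u : Dˣ, (u : D) = 1 + f • x ∧ (u : D) ∈ L.nearOne t := by
  have ht0 : t ≠ 0 := fun h => ht (by simp [h])
  obtain ⟨f, hf, -, hfx⟩ := L.exists_smul_mem x
  have hu : 1 + (t * f) • x ∈ L.nearOne t := ⟨f • x, hfx, by rw [mul_smul]⟩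
  exact ⟨t * f, mul_ne_zero ht0 hf, Units.mk0 _ (ne_zero_of_mem_nearOne ht hu), rfl, hu⟩

theorem inv_mul_notMem (hπi : π⁻¹ ∉ V) {s : F} (hs : s ∈ V) (hs0 : s ≠ 0) :
    (π * s)⁻¹ ∉ V :=
  fun h => hπi (by
    have h1 := V.mul_mem _ _ hs h
    rwa [mul_inv_rev, mul_inv_cancel_left₀ hs0] at h1)

/-- Raising `⁅c, a⁆ * a = c * a * c⁻¹` to the power `n` gives `⁅c, a⁆ ^ n = 1`, and torsion near `1`
is trivial. -/
theorem commute_of_commute_commutator (hπ : π ∈ V) (hπ0 : π ≠ 0)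
    (hq : ∀ q : ℕ, q.Prime → (q : F) ≠ 0 → π⁻¹ * q ∉ V) {n : ℕ} (hn : 0 < n) {a c : Dˣ}
    (han : (a : D) ^ n ∈ Subring.center D) (hc : ((⁅c, a⁆ : Dˣ) : D) ∈ L.nearOne π)
    (hca : Commute ⁅c, a⁆ a) : Commute c a := by
  have h1 : ⁅c, a⁆ * a = c * a * c⁻¹ := by simp [commutatorElement_def]
  have h2 : a ^ n * c = c * a ^ n := by
    ext
    simpa using (Subring.mem_center_iff.1 han (c : D)).symm
  have h3 : ⁅c, a⁆ ^ n * a ^ n = a ^ n := by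
    rw [← hca.mul_pow, h1, conj_pow, ← h2, mul_inv_cancel_right]
  have h4 : ⁅c, a⁆ ^ n = 1 := by simpa using h3
  have h5 := eq_one_of_pow_eq_one_of_mem_nearOne hπ hπ0 hq hn hc
    (by rw [← Units.val_pow_eq_pow_val, h4, Units.val_one])
  exact commutatorElement_eq_one_iff_commute.1 (Units.ext h5)

theorem commute_of_commute_iterate_commutator (hπ : π ∈ V) (hπ0 : π ≠ 0)
    (hq : ∀ q : ℕ, q.Prime → (q : F) ≠ 0 → π⁻¹ * q ∉ V) {n : ℕ} (hn : 0 < n) {a u : Dˣ}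
    (han : (a : D) ^ n ∈ Subring.center D) {r : ℕ}
    (hc : ∀ i ≤ r, (((fun c => ⁅c, a⁆)^[i] u : Dˣ) : D) ∈ L.nearOne π)
    (hca : Commute ((fun c => ⁅c, a⁆)^[r] u) a) : Commute u a := by
  induction r with
  | zero => simpa using hca
  | succ r ih =>
    refine ih (fun i hi => hc i (by omega)) ?_
    have h1 := hc (r + 1) le_rfl
    rw [Function.iterate_succ_apply'] at hca h1
    exact commute_of_commute_commutator hπ hπ0 hq hn han h1 hca

end MulLattice

/-! ### Purely inseparable elements -/

/-- If `a` is a noncentral element of a division ring of characteristic `p` whose `p`-th power is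
central, then some conjugate `a x a⁻¹` equals `x + 1`. -/
theorem exists_mul_eq_add_one_mul {D : Type*} [DivisionRing D] (p : ℕ) [ExpChar D p] {a : D}
    (ha : a ∉ Subring.center D) (hap : a ^ p ∈ Subring.center D) : ∃ x : D, a * x = (x + 1) * a := by
  have hp : ExpChar (Module.End ℤ D) p := by
    cases ‹ExpChar D p› with
    | zero => simp_all
    | prime hp =>
      refine expChar_of_natCast_prime_eq_zero hp (LinearMap.ext fun x => ?_)
      simp
  set δ : Module.End ℤ D := LinearMap.mulLeft ℤ a - LinearMap.mulRight ℤ a with hδ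
  have hδa : ∀ y, δ y = a * y - y * a := fun y => by simp [hδ]
  have hδp : δ ^ p = 0 := by
    rw [hδ, sub_pow_expChar_of_commute p (LinearMap.commute_mulLeft_right a a),
      LinearMap.pow_mulLeft, LinearMap.pow_mulRight]
    ext y
    simpa [sub_eq_zero] using (Subring.mem_center_iff.1 hap y).symm
  obtain ⟨y, hy⟩ : ∃ y, δ y ≠ 0 := by
    by_contra! h
    exact ha (Subring.mem_center_iff.2 fun y => by simpa [hδa, sub_eq_zero, eq_comm] using h y)
  classical
  have hex : ∃ k, (δ ^ k) y = 0 := ⟨p, by simp [hδp]⟩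
  -- `δ` is nilpotent; below, `z` is its last nonzero iterate on `y`. Since `z` commutes with `a`
  -- and `z = δ y'`, one gets `δ (y' * z⁻¹ * a) = a`.
  obtain ⟨k, hk, hmin⟩ : ∃ k, (δ ^ k) y = 0 ∧ ∀ j < k, (δ ^ j) y ≠ 0 :=
    ⟨Nat.find hex, Nat.find_spec hex, fun j hj => Nat.find_min hex hj⟩
  have hk2 : 2 ≤ k := by
    rcases k with _ | _ | k
    · simp_all
    · simp_all
    · omega
  obtain ⟨k, rfl⟩ := Nat.exists_eq_add_of_le' hk2
  set y' := (δ ^ k) y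
  have hz0 : δ y' ≠ 0 := by
    have := hmin (k + 1) (by omega)
    rwa [pow_succ', Module.End.mul_apply] at this
  have hz1 : δ (δ y') = 0 := by
    rwa [show k + 2 = k + 1 + 1 from rfl, pow_succ', pow_succ', Module.End.mul_apply,
      Module.End.mul_apply] at hk
  set z := δ y' with hz
  rw [hδa, sub_eq_zero] at hz1
  have hza : a * z⁻¹ = z⁻¹ * a := (Commute.inv_right₀ (show Commute a z from hz1)).eq
  refine ⟨y' * z⁻¹ * a, ?_⟩
  have h1 : a * y' = y' * a + z := by rw [hz, hδa]; abel
  calc a * (y' * z⁻¹ * a) = a * y' * z⁻¹ * a := by simp only [mul_assoc]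
    _ = y' * (a * z⁻¹) * a + z * z⁻¹ * a := by rw [h1]; simp only [add_mul, mul_assoc]
    _ = (y' * z⁻¹ * a + 1) * a := by
      rw [hza, mul_inv_cancel₀ hz0]; simp only [add_mul, mul_assoc]

/-! ### Radical subnormal subgroups over a valued field -/

namespace MulLattice

variable {F : Type*} [Field F] {V : ValuationSubring F} {D : Type*} [DivisionRing D] [Algebra F D]
  {π : F}

/-- Elements of a radical subnormal subgroup are central if the subgroup contains no noncentral
element that is purely inseparable over the center. -/
theorem mem_center_of_forall_pow_expChar (L : MulLattice V D) (hπ : π ∈ V) (hπ0 : π ≠ 0)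
    (hπi : π⁻¹ ∉ V)
    (hq : ∀ q : ℕ, q.Prime → (q : F) ≠ 0 → π⁻¹ * q ∉ V) (p : ℕ) [ExpChar F p] {N : Subgroup Dˣ}
    (hN : N.IsSubnormal) (hrad : ∀ u ∈ N, ∃ n : ℕ, 0 < n ∧ (u : D) ^ n ∈ Subring.center D)
    (hsep : ∀ u ∈ N, ∀ e : ℕ, (u : D) ^ p ^ e ∈ Subring.center D → (u : D) ∈ Subring.center D)
    {a : Dˣ} (ha : a ∈ N) : (a : D) ∈ Subring.center D := by
  obtain ⟨r, hr⟩ := hN.exists_iterate_commutator_mem ha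
  obtain ⟨n, hn, han⟩ := hrad a ha
  obtain ⟨s, hs, hsV, h⟩ := exists_iterate_commutator_mem_nearOne (L := L) hπi a r
  rw [Subring.mem_center_iff]
  intro b
  obtain ⟨f, hf, u, hu, hu'⟩ := exists_unit_mem_nearOne (L := L) (inv_mul_notMem hπi hsV hs) b
  obtain ⟨m, hm, hcm⟩ := hrad _ (hr u)
  obtain ⟨e, he⟩ := exists_pow_expChar_mem_center p hπ hπ0 hπi hq hm (h u hu' r le_rfl) hcm
  have hc := hsep _ (hr u) e he
  have hua := commute_of_commute_iterate_commutator hπ hπ0 hq hn han (h u hu')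
    (Units.ext (Subring.mem_center_iff.1 hc a).symm)
  have h1 := congrArg Units.val hua.eq
  simp only [Units.val_mul, hu, add_mul, mul_add, one_mul, mul_one, smul_mul_assoc,
    mul_smul_comm] at h1
  exact smul_right_injective D hf (add_left_cancel h1)

/-- An element of a radical subnormal subgroup whose `p`-th power is central is central. -/
theorem mem_center_of_pow_expChar_mem_center (L : MulLattice V D) (hπ : π ∈ V) (hπ0 : π ≠ 0)
    (hπi : π⁻¹ ∉ V)
    (hq : ∀ q : ℕ, q.Prime → (q : F) ≠ 0 → π⁻¹ * q ∉ V) (p : ℕ) [ExpChar F p] {N : Subgroup Dˣ}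
    (hN : N.IsSubnormal) (hrad : ∀ u ∈ N, ∃ n : ℕ, 0 < n ∧ (u : D) ^ n ∈ Subring.center D)
    {a : Dˣ} (ha : a ∈ N) (hap : (a : D) ^ p ∈ Subring.center D) :
    (a : D) ∈ Subring.center D := by
  by_contra hac
  have hD : ExpChar D p := expChar_of_injective_algebraMap (algebraMap F D).injective p
  obtain ⟨x, hx⟩ := exists_mul_eq_add_one_mul p hac hap
  obtain ⟨r, hr⟩ := hN.exists_iterate_commutator_mem ha
  obtain ⟨s, hs, hsV, h⟩ := exists_iterate_commutator_mem_nearOne (L := L) hπi a r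
  obtain ⟨f, hf, u, hu, hu'⟩ := exists_unit_mem_nearOne (L := L) (inv_mul_notMem hπi hsV hs) x
  -- The double centralizer of `x` is commutative, and it is stable under conjugation by `a` because
  -- `x` and `x + 1` have the same centralizer.
  let C : Subgroup Dˣ := Subgroup.centralizer {v : Dˣ | Commute (v : D) x}
  have huC : u ∈ C := by
    rw [Subgroup.mem_centralizer_iff]
    intro v hv
    have hv' : Commute (v : D) x := hv
    ext
    rw [Units.val_mul, Units.val_mul, hu]
    exact ((Commute.one_right _).add_right (hv'.smul_right f)).eq
  have hconj : ∀ c ∈ C, a * c * a⁻¹ ∈ C := by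
    intro c hc
    rw [Subgroup.mem_centralizer_iff] at hc ⊢
    intro v hv
    have hv' : Commute (v : D) (x + 1) := Commute.add_right hv (Commute.one_right _)
    have h1 : Commute ((a⁻¹ * v * a : Dˣ) : D) x := by
      have e : x = ((a⁻¹ : Dˣ) : D) * (x + 1) * a := by
        rw [mul_assoc, ← hx, Units.inv_mul_cancel_left]
      change _ * _ = _ * _
      rw [e]
      simp only [Units.val_mul, mul_assoc, Units.mul_inv_cancel_left]
      rw [← mul_assoc (v : D), hv'.eq, mul_assoc]
    have h2 := hc _ h1
    calc v * (a * c * a⁻¹) = a * (a⁻¹ * v * a * c) * a⁻¹ := by group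
      _ = a * c * a⁻¹ * v := by rw [h2]; group
  have hcomm : ∀ c ∈ C, ∀ d ∈ C, Commute c d := by
    intro c hc d hd
    have hxd : Commute (d : D) x := by
      by_cases hx0 : x = 0
      · simp [hx0]
      have := Subgroup.mem_centralizer_iff.1 hd (Units.mk0 x hx0) (Commute.refl x)
      exact (congrArg Units.val this).symm
    exact (Subgroup.mem_centralizer_iff.1 hc d hxd).symm
  have hiter : ∀ i, (fun c => ⁅c, a⁆)^[i] u ∈ C := by
    intro i
    induction i with
    | zero => exact huC
    | succ i ih =>
      rw [Function.iterate_succ_apply', commutatorElement_def, mul_assoc, mul_assoc, ← mul_assoc a]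
      exact C.mul_mem ih (hconj _ (C.inv_mem ih))
  obtain ⟨m, hm, hcm⟩ := hrad _ (hr u)
  obtain ⟨e, he⟩ := exists_pow_expChar_mem_center p hπ hπ0 hπi hq hm (h u hu' r le_rfl) hcm
  have hca : Commute ((fun c => ⁅c, a⁆)^[r] u) a := by
    have hcC := hiter r
    generalize (fun c => ⁅c, a⁆)^[r] u = c at hcC he
    have h1 : Commute ((a * c * a⁻¹ : Dˣ) : D) (c : D) :=
      congrArg Units.val (hcomm _ (hconj c hcC) c hcC).eq
    have h2 : ((a * c * a⁻¹ : Dˣ) : D) ^ p ^ e = (c : D) ^ p ^ e := by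
      rw [← Units.val_pow_eq_pow_val, conj_pow, Units.val_mul, Units.val_mul,
        Units.val_pow_eq_pow_val, Subring.mem_center_iff.1 he a, Units.mul_inv_cancel_right]
    -- The conjugate commutes with `c` and has the same `p ^ e`-th power, so their difference is
    -- nilpotent, hence zero.
    have h3 := sub_pow_expChar_pow_of_commute p e h1
    rw [h2, sub_self] at h3
    have h4 : a * c * a⁻¹ = c := Units.ext (sub_eq_zero.1 (eq_zero_of_pow_eq_zero h3))
    exact (mul_inv_eq_iff_eq_mul.1 h4).symm
  obtain ⟨n, hn, han⟩ := hrad a ha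
  have hua := commute_of_commute_iterate_commutator hπ hπ0 hq hn han (h u hu') hca
  have h1 := congrArg Units.val hua.eq
  simp only [Units.val_mul, hu, add_mul, mul_add, one_mul, mul_one, smul_mul_assoc,
    mul_smul_comm] at h1
  have h2 := smul_right_injective D hf (add_left_cancel h1)
  simp only [hx, add_mul, one_mul] at h2
  simp at h2

end MulLattice

/-! ### The finite-dimensional case and the reduction to it -/

section FiniteDimensional

variable {F : Type*} [Field F] {D : Type*} [DivisionRing D] [Algebra F D] [FiniteDimensional F D]

theorem mem_center_of_isSubnormal_of_not_isIntegral (hF : ∃ x : F, ¬ IsIntegral ℤ x)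
    {N : Subgroup Dˣ} (hN : N.IsSubnormal)
    (hrad : ∀ u ∈ N, ∃ n : ℕ, 0 < n ∧ (u : D) ^ n ∈ Subring.center D)
    {a : Dˣ} (ha : a ∈ N) : (a : D) ∈ Subring.center D := by
  obtain ⟨V, π, hπ0, hπ, hπi, hq⟩ := exists_valuationSubring_scale hF
  obtain ⟨p, hp⟩ := ExpChar.exists F
  obtain ⟨L⟩ := MulLattice.nonempty V D
  refine L.mem_center_of_forall_pow_expChar hπ hπ0 hπi hq p hN hrad (fun u hu e => ?_) ha
  induction e generalizing u with
  | zero => simp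
  | succ e ih =>
    intro he
    rw [pow_succ', pow_mul, ← Units.val_pow_eq_pow_val u] at he
    have h1 := ih _ (N.pow_mem hu p) he
    rw [Units.val_pow_eq_pow_val] at h1
    exact L.mem_center_of_pow_expChar_mem_center hπ hπ0 hπi hq p hN hrad hu h1

/-- A division algebra of finite dimension over a field integral over `ℤ` (that is, over a field
algebraic over a finite field) is commutative. -/
theorem mul_comm_of_forall_isIntegral (hF : ∀ x : F, IsIntegral ℤ x) (x y : D) :
    x * y = y * x := by
  obtain ⟨p, hp⟩ := CharP.exists F
  rcases CharP.char_is_prime_or_zero F p with hpp | rfl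
  swap
  · have : CharZero F := CharP.charP_to_charZero F
    exact absurd (hF _) not_isIntegral_inv_two
  have : Fact p.Prime := ⟨hpp⟩
  let := ZMod.algebra F p
  let b := Module.finBasis F D
  -- Structure constants and the coordinates of `1`, `x`, `y` generate a finite field `K`; elements
  -- with coordinates in `K` form a finite subring containing `x` and `y`.
  let S : Set F := Set.range (fun t : Fin _ × Fin _ × Fin _ => b.repr (b t.1 * b t.2.1) t.2.2) ∪
    (Set.range (b.repr 1) ∪ (Set.range (b.repr x) ∪ Set.range (b.repr y)))
  have hS : S.Finite := (Set.finite_range _).union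
    ((Set.finite_range _).union ((Set.finite_range _).union (Set.finite_range _)))
  let K := IntermediateField.adjoin (ZMod p) S
  have : Finite S := hS
  have : FiniteDimensional (ZMod p) K :=
    IntermediateField.finiteDimensional_adjoin fun z _ => (hF z).tower_top
  have : Finite K := Module.finite_of_finite (ZMod p)
  have hSK : S ⊆ K := IntermediateField.subset_adjoin (ZMod p) S
  let R : Subring D :=
    { carrier := {z | ∀ i, b.repr z i ∈ K}
      one_mem' := fun i => hSK (.inr (.inl ⟨i, rfl⟩))
      zero_mem' := fun i => by simp
      add_mem' := fun hz hw i => by simpa using add_mem (hz i) (hw i)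
      neg_mem' := fun hz i => by simpa using hz i
      mul_mem' := by
        intro z w hz hw k
        have key : b.repr (z * w) k =
            ∑ i, ∑ j, b.repr z i * b.repr w j * b.repr (b i * b j) k := by
          conv_lhs => rw [← b.sum_repr z, ← b.sum_repr w]
          simp only [Finset.sum_mul_sum, smul_mul_smul_comm, map_sum, map_smul,
            Finsupp.coe_finsetSum, Finset.sum_apply, Finsupp.smul_apply, smul_eq_mul]
        rw [key]
        exact sum_mem fun i _ => sum_mem fun j _ => mul_mem (mul_mem (hz i) (hw j))
          (hSK (.inl ⟨(i, j, k), rfl⟩)) }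
  have : Finite R := by
    refine Finite.of_injective (fun z : R => fun i => (⟨b.repr z i, z.2 i⟩ : K)) fun z w h => ?_
    apply Subtype.ext
    apply b.repr.injective
    ext i
    exact congrArg Subtype.val (congrFun h i)
  have hx : x ∈ R := fun i => hSK (.inr (.inr (.inl ⟨i, rfl⟩)))
  have hy : y ∈ R := fun i => hSK (.inr (.inr (.inr ⟨i, rfl⟩)))
  exact congrArg Subtype.val ((Finite.isDomain_to_isField R).mul_comm ⟨x, hx⟩ ⟨y, hy⟩)

end FiniteDimensional

/-- In a finite-dimensional division algebra, a subnormal subgroup of the multiplicative group that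
is radical over the center is central. -/
theorem mem_center_of_isSubnormal {D : Type*} [DivisionRing D] (F : Type*) [Field F] [Algebra F D] [FiniteDimensional F D]
    {N : Subgroup Dˣ} (hN : N.IsSubnormal)
    (hrad : ∀ u ∈ N, ∃ n : ℕ, 0 < n ∧ (u : D) ^ n ∈ Subring.center D)
    {a : Dˣ} (ha : a ∈ N) : (a : D) ∈ Subring.center D := by
  by_cases hF : ∀ x : F, IsIntegral ℤ x
  · exact Subring.mem_center_iff.2 fun y => mul_comm_of_forall_isIntegral hF y a
  · push Not at hF
    exact mem_center_of_isSubnormal_of_not_isIntegral hF hN hrad ha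

theorem theorem3p3 {D : Type*} [DivisionRing D] (hD : IsWeaklyLocallyFinite D)
    (N : Subgroup Dˣ) (hN : N.IsSubnormal)
    (hrad : IsRadicalOver ((fun u : Dˣ => (u : D)) '' (N : Set Dˣ)) (Subring.center D)) :
    (fun u : Dˣ => (u : D)) '' (N : Set Dˣ) ⊆ (Subring.center D : Set D) := by
  rintro _ ⟨a, ha, rfl⟩
  rw [SetLike.mem_coe, Subring.mem_center_iff]
  intro b
  let E : Subfield D := Subfield.closure {(a : D), b}
  have hE : FiniteDimensional (Subring.center E) E := hD {(a : D), b} (Set.toFinite _)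
  have haE : (a : D) ∈ E := Subfield.subset_closure (by simp)
  have hbE : b ∈ E := Subfield.subset_closure (by simp)
  let ι : Eˣ →* Dˣ := Units.map (E.subtype : E →* D)
  let a' : Eˣ := Units.mk0 ⟨a, haE⟩ (fun h => a.ne_zero (congrArg Subtype.val h))
  have ha' : a' ∈ N.comap ι := by
    have : ι a' = a := Units.ext rfl
    rwa [Subgroup.mem_comap, this]
  have hc := mem_center_of_isSubnormal (Subring.center E) (hN.comap ι) (fun u hu => by
    obtain ⟨n, hn, h⟩ := hrad _ ⟨ι u, hu, rfl⟩
    refine ⟨n, hn, Subring.mem_center_iff.2 fun y => Subtype.ext ?_⟩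
    exact Subring.mem_center_iff.1 h y) ha'
  exact congrArg Subtype.val (Subring.mem_center_iff.1 hc ⟨b, hbE⟩)
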